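/- Let $(K,v)$ be a valued field with residue characteristic $p\ge 0$, let $n\ge 1$, and suppose that the complete theory of $(K,v)$ in the language of valued fields (the language of rings with a unary predicate for the valuation ring) is $\mathrm{NIP}_n$. That is, for no formula $\varphi(x;y_1,\dots,y_n)$ (with $x,y_1,\dots,y_n$ finite tuples of variables) are there, in some model of this theory, tuples $(a^k_i)_{1\le k\le n,\ i<\omega}$ and $(b_J)_{J\subseteq\omega^n}$ such that, for all $J\subseteq\omega^n$ and $(i_1,\dots,i_n)\in\omega^n$, $\varphi(b_J;a^1_{i_1},\dots,a^n_{i_n})$ holds if and only if $(i_1,\dots,i_n)\in J$. If $p>0$, suppose moreover that $(K,v)$ is $p$-henselian, i.e. $v$ extends uniquely (up to equivalence) to every finite Galois extension of $K$ of $p$-power degree; if $p=0$, no henselianity is assumed. Valuations are considered up to equivalence, and a coarsening of $v$ is a valuation on $K$ whose valuation ring contains that of $v$ (so $v$ itself and the trivial valuation are coarsenings of $v$). Then $v$ has at most one coarsening with imperfect residue field. Moreover, if $w$ is a coarsening of $v$ with imperfect residue field, then $p>0$ and $w$ is the coarsest coarsening of $v$ with residue characteristic $p$, i.e. $w$ has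 residue characteristic $p$ and its valuation ring contains the valuation ring of every coarsening of $v$ with residue characteristic $p$. -/

import Mathlib

/-- The only symbol added to the language of rings: a unary predicate. -/
inductive ValuationRel : ℕ → Type
  | isInteger : ValuationRel 1

/-- The language consisting of a single unary predicate. -/
def valuationPredicate : FirstOrder.Language.{0, 0} := ⟨fun _ => Empty, ValuationRel⟩

/-- The (one-sorted) language of valued fields: the language of rings together with a unary
predicate for the valuation ring. -/
abbrev valuedFieldLanguage : FirstOrder.Language.{0, 0} := FirstOrder.Language.ring.sum valuationPredicate

/-- A valued field `(K, v)`, where `v` is given by its valuation ring, as a first-order structure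
in the language of valued fields. The ring symbols have their usual meaning and the unary
predicate holds exactly on the valuation ring. -/
@[reducible] noncomputable def valuedFieldStructure {K : Type*} [Field K]
    (v : ValuationSubring K) : valuedFieldLanguage.Structure K :=
  letI : FirstOrder.Language.ring.Structure K := (FirstOrder.Ring.compatibleRingOfRing K).toStructure
  letI : valuationPredicate.Structure K :=
    { funMap := fun f => nomatch f
      RelMap := fun r x => match r with
        | ValuationRel.isInteger => x 0 ∈ v }
  inferInstance

/-- The complete theory of the valued field `(K, v)` in the language of valued fields. -/
noncomputable def valuedFieldTheory {K : Type*} [Field K] (v : ValuationSubring K) :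
    valuedFieldLanguage.Theory :=
  letI := valuedFieldStructure v
  valuedFieldLanguage.completeTheory K

/-- The formula `φ(x; y₁, …, yₙ)`, where `x` is an `r`-tuple of variables and `yₖ` is an
`s k`-tuple of variables, has the independence property of order `n` with respect to the complete
theory `T`. Having such a configuration in some model of `T` is the same as having one in a monster
model; as the configuration has at most continuum many parameters and `L` lies in the lowest
universe, models in the lowest universe suffice (downward Löwenheim–Skolem). -/
def HasIndependenceProperty {L : FirstOrder.Language.{0, 0}} (T : L.Theory) (n : ℕ) {r : ℕ} {s : Fin n → ℕ}
    (φ : L.Formula (Fin r ⊕ (Σ k : Fin n, Fin (s k)))) : Prop :=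
  ∃ (M : FirstOrder.Language.Theory.ModelType.{0, 0, 0} T)
    (a : (k : Fin n) → ℕ → Fin (s k) → M) (b : Set (Fin n → ℕ) → Fin r → M),
    ∀ (J : Set (Fin n → ℕ)) (i : Fin n → ℕ),
      φ.Realize (Sum.elim (b J) (fun z => a z.1 (i z.1) z.2)) ↔ i ∈ J

/-- `T` is `NIPₙ`: no formula has the independence property of order `n`. -/
def IsNIP {L : FirstOrder.Language.{0, 0}} (T : L.Theory) (n : ℕ) : Prop :=
  ∀ (r : ℕ) (s : Fin n → ℕ) (φ : L.Formula (Fin r ⊕ (Σ k : Fin n, Fin (s k)))),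
    ¬ HasIndependenceProperty T n φ

/-- `(K, v)` is `p`-henselian: `v` has, up to equivalence, exactly one extension to every finite
Galois extension of `K` of `p`-power degree (equivalently, to the compositum `K(p)` of all of
these). -/
def IsPHenselian {K : Type*} [Field K] (p : ℕ) (v : ValuationSubring K) : Prop :=
  ∀ F : IntermediateField K (AlgebraicClosure K), FiniteDimensional K F → IsGalois K F →
    (∃ m : ℕ, Module.finrank K F = p ^ m) →
      ∃! u : ValuationSubring F, u.comap (algebraMap K F) = v

/-!
The proof produces, from two coarsenings `w < u` of `v` of residue characteristic `p > 0` such that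
`w` has imperfect residue field, the independence property of every order `n`. Everything else is
formal: a coarsening with imperfect residue field has the residue characteristic `p > 0` of `v`
(`ValuationSubring.charP_of_not_perfectField`), and the coarsenings of `v` are linearly ordered, so
such a coarsening `w` must contain every coarsening of residue characteristic `p`, and there is at
most one such `w`.

The formula that witnesses the independence property is
`∃ z y ∈ 𝒪ᵥ, (∏ₖ yₖ) x = z ^ p - c z + p y`. For fixed `c ∈ 𝒪ᵥ` its right-hand side runs over a
subgroup `G` of `𝒪ᵥ`, the preimage of the range of the additive map `z ↦ z ^ p - c z` of the ring
`𝒪ᵥ / p`. It has to be shown that the groups `β⁻¹ G`, for a finite set of suitable `β`, are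
independent; `ValuationSubring.exists_forall_mul_mem_iff` does this, and compactness
(`hasIndependenceProperty_of_boxes`) passes from finite boxes to an infinite pattern.

The ring `𝒪ᵥ / p` has characteristic `p` and, unlike the residue field of `u`, is always definable.
The configuration in it is built as follows.
* Choose `t` of positive `w`-value that is a `u`-unit. It is transcendental over `𝔽_p` in the
  residue field of `u` (`ValuationSubring.transcendental_residue`), so its powers `θᵢ` are linearly
  independent over `𝔽_p`. Put `βᵢ = θᵢ ^ p ^ M` with `M` large.
* For each `i` there is an additive polynomial `L = ∑ aₘ T ^ p ^ m` of degree at most `p ^ M` that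
  vanishes at the `θⱼ`, `j ≠ i`, and not at `θᵢ` (`exists_additivePolynomial`).
* Modulo `{z ^ p - z}` every element is congruent to all of its `p ^ l`-th powers. Hence
  `x = ∑ (aₘ s) ^ p ^ (M - m)` satisfies `βⱼ x ≡ L(θⱼ) s` for every `j`. The parameter `c` and the
  powers of `D` in `additivePolynomialLift` come from clearing the denominator in `s`, an element
  of negative value. So `βⱼ x ∈ G` for `j ≠ i`.
* With `α` a unit of `w` whose residue is not a `p`-th power, `s` is chosen such that `L(θᵢ) s` is
  `α` times a `p`-th power of negative `w`-value. Then `z ^ p - z ≡ L(θᵢ) s` would make the residue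
  of `α` a `p`-th power (`ValuationSubring.twistedArtinSchreier_ne`), so `βᵢ x ∉ G`.
-/

/-! ### Compactness and the witnessing formula -/

open FirstOrder FirstOrder.Language in
/-- **Compactness.** A pattern that `φ` realizes on every finite box in one structure `K`, in an
arbitrary universe, is realized on the whole of `ℕⁿ` in some model of the theory of `K`. -/
theorem hasIndependenceProperty_of_boxes {L : FirstOrder.Language.{0, 0}} (K : Type*)
    [L.Structure K] [Nonempty K] {n r : ℕ} {s : Fin n → ℕ}
    (φ : L.Formula (Fin r ⊕ (Σ k : Fin n, Fin (s k))))
    (h : ∀ N : ℕ, ∃ (a : (k : Fin n) → ℕ → Fin (s k) → K) (b : Set (Fin n → ℕ) → Fin r → K),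
      ∀ (J : Set (Fin n → ℕ)) (i : Fin n → ℕ), (∀ k, i k < N) →
        (φ.Realize (Sum.elim (b J) (fun z => a z.1 (i z.1) z.2)) ↔ i ∈ J)) :
    HasIndependenceProperty (L.completeTheory K) n φ := by
  -- One constant symbol for each coordinate of each parameter of the configuration.
  let A : Type := (Σ k : Fin n, ℕ × Fin (s k)) ⊕ (Set (Fin n → ℕ) × Fin r)
  let g : Set (Fin n → ℕ) → (Fin n → ℕ) → Fin r ⊕ (Σ k : Fin n, Fin (s k)) → A := fun J i =>
    Sum.elim (fun x => Sum.inr (J, x)) (fun z => Sum.inl ⟨z.1, (i z.1, z.2)⟩)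
  let ψ : Set (Fin n → ℕ) → (Fin n → ℕ) → L[[A]].Sentence := fun J i =>
    Formula.equivSentence (φ.relabel (g J i))
  let χ : Set (Fin n → ℕ) → (Fin n → ℕ) → L[[A]].Sentence := fun J i =>
    Formula.equivSentence (φ.relabel (g J i)).not
  let T : ℕ → L[[A]].Theory := fun N =>
    (L.lhomWithConstants A).onTheory (L.completeTheory K) ∪
      {σ | ∃ J i, (∀ k, i k < N) ∧ ((i ∈ J ∧ σ = ψ J i) ∨ (i ∉ J ∧ σ = χ J i))}
  have hT : Monotone T := by
    intro N N' hN
    refine Set.union_subset_union_right _ ?_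
    rintro σ ⟨J, i, hi, hσ⟩
    exact ⟨J, i, fun k => (hi k).trans_le hN, hσ⟩
  have hsat : Theory.IsSatisfiable (⋃ N, T N) := by
    rw [Theory.isSatisfiable_directed_union_iff hT.directed_le]
    intro N
    obtain ⟨a, b, hab⟩ := h N
    let _ : (constantsOn A).Structure K :=
      constantsOn.structure (Sum.elim (fun z => a z.1 z.2.1 z.2.2) (fun z => b z.1 z.2))
    have hcon : ∀ J i, ((fun x => ((L.con x : L[[A]].Constants) : K)) ∘ g J i) =
        Sum.elim (b J) (fun z => a z.1 (i z.1) z.2) := by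
      intro J i
      funext x
      rcases x with x | x <;> rfl
    have : K ⊨ T N := by
      refine Theory.model_union_iff.2 ⟨(LHom.onTheory_model _ _).2 inferInstance, ⟨?_⟩⟩
      rintro σ ⟨J, i, hi, ⟨hJ, rfl⟩ | ⟨hJ, rfl⟩⟩
      · rw [Formula.realize_equivSentence, Formula.realize_relabel, hcon]
        exact (hab J i hi).2 hJ
      · rw [Formula.realize_equivSentence, Formula.realize_not, Formula.realize_relabel, hcon]
        exact fun h' => hJ ((hab J i hi).1 h')
    exact Theory.Model.isSatisfiable K
  obtain ⟨M⟩ := hsat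
  have hM : ∀ N, M ⊨ T N := fun N => M.is_model.mono (Set.subset_iUnion T N)
  let _ : L.Structure M := (L.lhomWithConstants A).reduct M
  have : (L.lhomWithConstants A).IsExpansionOn M := LHom.isExpansionOn_reduct _ _
  have : M ⊨ L.completeTheory K :=
    (LHom.onTheory_model (L.lhomWithConstants A) _).1 (Theory.model_union_iff.1 (hM 0)).1
  refine ⟨Theory.ModelType.of _ M, fun k m x => (L.con (Sum.inl ⟨k, (m, x)⟩ : A) : M),
    fun J x => (L.con (Sum.inr (J, x) : A) : M), fun J i => ?_⟩
  have hcon : ((fun x => ((L.con x : L[[A]].Constants) : M)) ∘ g J i) =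
      Sum.elim (fun x => (L.con (Sum.inr (J, x) : A) : M))
        (fun z => (L.con (Sum.inl ⟨z.1, (i z.1, z.2)⟩ : A) : M)) := by
    funext x
    rcases x with x | x <;> rfl
  obtain ⟨N, hN⟩ : ∃ N, ∀ k, i k < N :=
    ⟨Finset.univ.sup i + 1, fun k => Nat.lt_succ_of_le (Finset.le_sup (Finset.mem_univ k))⟩
  have hsent := (Theory.model_union_iff.1 (hM N)).2.realize_of_mem
  by_cases hJ : i ∈ J
  · have := hsent (ψ J i) ⟨J, i, hN, Or.inl ⟨hJ, rfl⟩⟩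
    rw [Formula.realize_equivSentence, Formula.realize_relabel, hcon] at this
    exact iff_of_true this hJ
  · have := hsent (χ J i) ⟨J, i, hN, Or.inr ⟨hJ, rfl⟩⟩
    rw [Formula.realize_equivSentence, Formula.realize_not, Formula.realize_relabel, hcon] at this
    exact iff_of_false this hJ

open FirstOrder FirstOrder.Language in
/-- The formula saying that the value of the term `t` lies in the valuation ring. -/
def isIntegralFormula {α : Type} {l : ℕ} (t : valuedFieldLanguage.Term (α ⊕ Fin l)) :
    valuedFieldLanguage.BoundedFormula α l :=
  Relations.boundedFormula₁ (Sum.inr ValuationRel.isInteger : valuedFieldLanguage.Relations 1) t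

theorem realize_isIntegralFormula {K : Type*} [Field K] (v : ValuationSubring K) {α : Type} {l : ℕ}
    (t : valuedFieldLanguage.Term (α ⊕ Fin l)) (x : α → K) (y : Fin l → K) :
    letI := valuedFieldStructure v
    (isIntegralFormula t).Realize x y ↔ t.realize (Sum.elim x y) ∈ v :=
  letI := valuedFieldStructure v
  FirstOrder.Language.BoundedFormula.realize_rel₁

open FirstOrder FirstOrder.Language in
/-- The formula saying that two integral polynomial expressions have the same value. -/
noncomputable def polynomialEqFormula {α : Type} {l : ℕ} (f g : FreeCommRing (α ⊕ Fin l)) :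
    valuedFieldLanguage.BoundedFormula α l :=
  ((LHom.sumInl : Language.ring →ᴸ valuedFieldLanguage).onTerm
    (Ring.termOfFreeCommRing f)).bdEqual
    ((LHom.sumInl : Language.ring →ᴸ valuedFieldLanguage).onTerm (Ring.termOfFreeCommRing g))

theorem realize_polynomialEqFormula {K : Type*} [Field K] (v : ValuationSubring K) {α : Type}
    {l : ℕ} (f g : FreeCommRing (α ⊕ Fin l)) (x : α → K) (y : Fin l → K) :
    letI := valuedFieldStructure v
    (polynomialEqFormula f g).Realize x y ↔
      FreeCommRing.lift (Sum.elim x y) f = FreeCommRing.lift (Sum.elim x y) g := by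
  let _ := FirstOrder.Ring.compatibleRingOfRing K
  let _ : valuationPredicate.Structure K :=
    { funMap := fun f => nomatch f
      RelMap := fun r x => match r with
        | ValuationRel.isInteger => x 0 ∈ v }
  simp only [polynomialEqFormula, FirstOrder.Language.BoundedFormula.realize_bdEqual,
    FirstOrder.Language.LHom.realize_onTerm, FirstOrder.Ring.realize_termOfFreeCommRing]

open FirstOrder FirstOrder.Language in
/-- The formula `∃ z w ∈ 𝒪, (∏ₖ yₖ) x₀ = z ^ p - x₁ z + p w` in the language of valued fields. -/
noncomputable def twistedArtinSchreierFormula (p n : ℕ) :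
    valuedFieldLanguage.Formula (Fin 2 ⊕ (Σ _ : Fin n, Fin 1)) :=
  (((isIntegralFormula (Term.var (Sum.inr 0)) ⊓ isIntegralFormula (Term.var (Sum.inr 1))) ⊓
    polynomialEqFormula
      ((∏ k, FreeCommRing.of (Sum.inl (Sum.inr ⟨k, 0⟩))) * FreeCommRing.of (Sum.inl (Sum.inl 0)))
      (FreeCommRing.of (Sum.inr 0) ^ p -
          FreeCommRing.of (Sum.inl (Sum.inl 1)) * FreeCommRing.of (Sum.inr 0) +
        (p : FreeCommRing _) * FreeCommRing.of (Sum.inr 1)) :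
    valuedFieldLanguage.BoundedFormula _ 2)).ex.ex

theorem realize_twistedArtinSchreierFormula {K : Type*} [Field K] (v : ValuationSubring K)
    (p n : ℕ) (x : Fin 2 → K) (y : (Σ _ : Fin n, Fin 1) → K) :
    letI := valuedFieldStructure v
    (twistedArtinSchreierFormula p n).Realize (Sum.elim x y) ↔
      ∃ z ∈ v, ∃ w ∈ v, (∏ k, y ⟨k, 0⟩) * x 0 = z ^ p - x 1 * z + (p : K) * w := by
  let _ := valuedFieldStructure v
  unfold twistedArtinSchreierFormula FirstOrder.Language.Formula.Realize
  simp only [FirstOrder.Language.BoundedFormula.realize_ex,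
    FirstOrder.Language.BoundedFormula.realize_inf,
    realize_isIntegralFormula, realize_polynomialEqFormula]
  simp [Fin.snoc, map_prod]
  grind

/-! ### Additive polynomials in characteristic `p` -/

/-- The image of the twisted Artin–Schreier map `z ↦ z ^ p - c z`, which is additive in
characteristic `p`. -/
def twistedArtinSchreierRange {R : Type*} [CommRing R] (p : ℕ) [ExpChar R p] (c : R) :
    AddSubgroup R :=
  ((frobenius R p : R →+ R) - AddMonoidHom.mulLeft c).range

theorem mem_twistedArtinSchreierRange {R : Type*} [CommRing R] {p : ℕ} [ExpChar R p] {c x : R} :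
    x ∈ twistedArtinSchreierRange p c ↔ ∃ z, z ^ p - c * z = x := by
  simp [twistedArtinSchreierRange, AddMonoidHom.mem_range, frobenius_def]

/-- After rescaling by powers of `D`, an element and its `p ^ l`-th power have the same class
modulo the range of the twisted Artin–Schreier map. -/
theorem pow_mul_sub_mem_twistedArtinSchreierRange {R : Type*} [CommRing R] {p : ℕ} [ExpChar R p]
    (D y : R) (m l : ℕ) (hl : l ≤ m + 1) :
    y ^ p ^ l * D ^ (p ^ (m + 1) - p ^ l) - y * D ^ (p ^ (m + 1) - 1) ∈
      twistedArtinSchreierRange p (D ^ (p ^ (m + 1) - p ^ m)) := by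
  have hp : 0 < p := expChar_pos R p
  induction l with
  | zero => simp
  | succ l ih =>
    have h := ih (by omega)
    refine (sub_add_sub_cancel _ _ (y * D ^ (p ^ (m + 1) - 1))) ▸ add_mem ?_ h
    rw [mem_twistedArtinSchreierRange]
    refine ⟨y ^ p ^ l * D ^ (p ^ m - p ^ l), ?_⟩
    have h1 : p ^ l ≤ p ^ m := Nat.pow_le_pow_right hp (by omega)
    have h2 : p ^ m ≤ p ^ (m + 1) := Nat.pow_le_pow_right hp (by omega)
    have e1 : p ^ (m + 1) - p ^ (l + 1) = (p ^ m - p ^ l) * p := by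
      rw [Nat.sub_mul, pow_succ, pow_succ]
    have e2 : p ^ (m + 1) - p ^ l = (p ^ (m + 1) - p ^ m) + (p ^ m - p ^ l) := by omega
    rw [e1, e2, pow_succ p l, pow_mul, pow_mul, pow_add, mul_pow]
    ring

/-- The element `X` with `θ ^ p ^ M * X` congruent to `D ^ (p ^ M - 1) * S * L(θ)` for all `θ`,
where `L = ∑ aₘ T ^ p ^ m` and the congruence is modulo a twisted Artin–Schreier range. -/
def additivePolynomialLift {R : Type*} [CommRing R] (p M : ℕ) (a : ℕ → R) (S D : R) : R :=
  ∑ m ∈ Finset.range (M + 1), (a m * S) ^ p ^ (M - m) * D ^ (p ^ M - p ^ (M - m))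

theorem pow_mul_additivePolynomialLift_sub_mem {R : Type*} [CommRing R] {p : ℕ} [ExpChar R p]
    (m : ℕ) (a : ℕ → R) (S D θ : R) :
    θ ^ p ^ (m + 1) * additivePolynomialLift p (m + 1) a S D -
      D ^ (p ^ (m + 1) - 1) * S * ∑ j ∈ Finset.range (m + 1 + 1), a j * θ ^ p ^ j ∈
      twistedArtinSchreierRange p (D ^ (p ^ (m + 1) - p ^ m)) := by
  rw [additivePolynomialLift, Finset.mul_sum, Finset.mul_sum, ← Finset.sum_sub_distrib]
  refine sum_mem fun j hj => ?_
  have hj' : j ≤ m + 1 := Nat.lt_succ_iff.1 (Finset.mem_range.1 hj)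
  have h := pow_mul_sub_mem_twistedArtinSchreierRange (p := p) D (θ ^ p ^ j * a j * S) m
    (m + 1 - j) (by omega)
  have e : θ ^ p ^ (m + 1) = (θ ^ p ^ j) ^ p ^ (m + 1 - j) := by
    rw [← pow_mul, ← pow_add, Nat.add_sub_cancel' hj']
  rw [e]
  convert h using 1
  ring

/-- A finite set of elements of `R` is killed by an additive polynomial `L` over `R`. It can be
chosen to have, after applying a homomorphism `π` to a field, no zeros outside the `𝔽_p`-span of the
given elements. The bound `p ^ M` on its degree is only required to be large enough. -/
theorem exists_additivePolynomial {R F ι : Type*} [CommRing R] [Field F] {p : ℕ} [Fact p.Prime]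
    [CharP R p] [Algebra (ZMod p) F] (π : R →+* F) (θ : ι → R) (s : Finset ι) (M : ℕ)
    (hM : s.card ≤ M) :
    ∃ a : ℕ → R,
      (∀ i ∈ s, ∑ m ∈ Finset.range (M + 1), a m * θ i ^ p ^ m = 0) ∧
      ∀ y : R, π (∑ m ∈ Finset.range (M + 1), a m * y ^ p ^ m) = 0 →
        π y ∈ Submodule.span (ZMod p) ((fun i => π (θ i)) '' (s : Set ι)) := by
  classical
  have hp : p.Prime := Fact.out
  have : CharP F p := charP_of_injective_algebraMap (algebraMap (ZMod p) F).injective p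
  induction s using Finset.induction_on generalizing M with
  | empty =>
    refine ⟨fun m => if m = 0 then 1 else 0, by simp, fun y hy => ?_⟩
    simpa [ite_mul, Finset.sum_ite_eq'] using hy
  | insert i s hi ih =>
    rw [Finset.card_insert_of_notMem hi] at hM
    obtain ⟨M, rfl⟩ : ∃ k, M = k + 1 := ⟨M - 1, by omega⟩
    obtain ⟨a, ha, hπ⟩ := ih M (by omega)
    set L : R → R := fun y => ∑ m ∈ Finset.range (M + 1), a m * y ^ p ^ m with hL
    -- `L` vanishes at the previous points, and `L ^ p - L(θᵢ) ^ (p - 1) L` also at `θᵢ`.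
    let a' : ℕ → R := fun m =>
      (if m = 0 then 0 else a (m - 1) ^ p) - L (θ i) ^ (p - 1) * (if m ≤ M then a m else 0)
    have hL' : ∀ y, ∑ m ∈ Finset.range (M + 1 + 1), a' m * y ^ p ^ m =
        L y ^ p - L (θ i) ^ (p - 1) * L y := by
      intro y
      simp only [a', sub_mul, Finset.sum_sub_distrib]
      congr 1
      · rw [Finset.sum_range_succ']
        simp only [hL, sum_pow_char, mul_pow, Nat.add_sub_cancel, if_neg (Nat.succ_ne_zero _)]
        simp [pow_succ, pow_mul]
      · rw [Finset.sum_range_succ, hL, Finset.mul_sum]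
        simp only [if_neg (show ¬ M + 1 ≤ M by omega), mul_zero, zero_mul, add_zero]
        refine Finset.sum_congr rfl fun m hm => ?_
        rw [if_pos (Nat.lt_succ_iff.1 (Finset.mem_range.1 hm)), mul_assoc]
    refine ⟨a', fun j hj => ?_, fun y hy => ?_⟩
    · rw [hL']
      rcases Finset.mem_insert.1 hj with rfl | hj
      · rw [← pow_succ, Nat.sub_add_cancel hp.one_le, sub_self]
      · rw [show L (θ j) = 0 from ha j hj, zero_pow hp.ne_zero, mul_zero, sub_zero]
    · rw [hL', map_sub, map_pow, map_mul, map_pow] at hy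
      -- The zeros are the `y` with `L(y) = λ L(θᵢ)`, that is `L(y - λ θᵢ) = 0`, for some `λ ∈ 𝔽_p`.
      obtain ⟨l, hl⟩ : ∃ l : ℕ, π (L y) = l * π (L (θ i)) := by
        by_cases h0 : π (L (θ i)) = 0
        · rw [h0, zero_pow (Nat.sub_ne_zero_of_lt hp.one_lt), zero_mul, sub_zero] at hy
          exact ⟨0, by simpa using pow_eq_zero_iff hp.ne_zero |>.1 hy⟩
        · have hq : (π (L y) / π (L (θ i))) ^ p = π (L y) / π (L (θ i)) := by
            have e : π (L (θ i)) ^ p = π (L (θ i)) ^ (p - 1) * π (L (θ i)) := by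
              rw [← pow_succ, Nat.sub_add_cancel hp.one_le]
            rw [div_pow, sub_eq_zero.1 hy, e]
            field_simp
          rw [← Subfield.mem_bot_iff_pow_eq_self, ← ZMod.fieldRange_castHom_eq_bot p] at hq
          obtain ⟨z, hz⟩ := hq
          obtain ⟨l, rfl⟩ := ZMod.natCast_zmod_surjective z
          rw [map_natCast] at hz
          exact ⟨l, by rw [hz, div_mul_cancel₀ _ h0]⟩
      have hadd : π (L (y - l * θ i)) = 0 := by
        have : L (y - l * θ i) = L y - l * L (θ i) := by
          simp only [hL, Finset.mul_sum, ← Finset.sum_sub_distrib]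
          refine Finset.sum_congr rfl fun m _ => ?_
          have hlp : ((l : R)) ^ p ^ m = l := by
            have : (l : R) = ZMod.castHom (dvd_refl p) R (l : ZMod p) := by simp
            rw [this, ← map_pow, ZMod.pow_card_pow]
          rw [sub_pow_char_pow, mul_pow, hlp]
          ring
        rw [this, map_sub, map_mul, map_natCast, hl, sub_self]
      have h := hπ _ hadd
      rw [map_sub, map_mul, map_natCast] at h
      have h2 : (l : F) * π (θ i) ∈ Submodule.span (ZMod p)
          ((fun i => π (θ i)) '' ((insert i s : Finset ι) : Set ι)) := by
        rw [← nsmul_eq_mul]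
        exact Submodule.smul_of_tower_mem _ l (Submodule.subset_span ⟨i, by simp, rfl⟩)
      have := add_mem (Submodule.span_mono (Set.image_mono (by simp)) h) h2
      simpa using this

/-! ### Valuation rings and their residue fields -/

namespace ValuationSubring

variable {K : Type*} [Field K]

theorem mul_mem_nonunits_of_mem {w : ValuationSubring K} {x y : K} (hx : x ∈ w)
    (hy : y ∈ w.nonunits) : x * y ∈ w.nonunits := by
  rw [mem_nonunits_iff] at hy ⊢
  rw [map_mul]
  exact (mul_le_of_le_one_left' ((w.valuation_le_one_iff x).2 hx)).trans_lt hy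

theorem pow_mem_nonunits {w : ValuationSubring K} {x : K} (hx : x ∈ w.nonunits) {k : ℕ}
    (hk : k ≠ 0) : x ^ k ∈ w.nonunits := by
  rw [mem_nonunits_iff] at hx ⊢
  rw [map_pow]
  exact pow_lt_one' hx hk

theorem mem_of_mem_nonunits {w : ValuationSubring K} {x : K} (hx : x ∈ w.nonunits) : x ∈ w :=
  w.nonunits_subset hx

theorem inv_mem_of_notMem_nonunits {w : ValuationSubring K} {x : K} (hx : x ∉ w.nonunits) :
    x⁻¹ ∈ w := by
  rw [mem_nonunits_iff_or] at hx
  tauto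

theorem mul_notMem_nonunits {w : ValuationSubring K} {x y : K} (hx : x ∉ w.nonunits)
    (hy : y ∉ w.nonunits) : x * y ∉ w.nonunits := by
  simp only [mem_nonunits_iff, not_lt, map_mul] at *
  exact one_le_mul hx hy

theorem one_notMem_nonunits (w : ValuationSubring K) : (1 : K) ∉ w.nonunits := by
  simp [mem_nonunits_iff]

theorem pow_notMem_nonunits {w : ValuationSubring K} {x : K} (hx : x ∉ w.nonunits) (k : ℕ) :
    x ^ k ∉ w.nonunits := by
  simp only [mem_nonunits_iff, not_lt, map_pow] at *
  exact one_le_pow_of_one_le' hx k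

theorem prod_notMem_nonunits {w : ValuationSubring K} {ι : Type*} {s : Finset ι} {x : ι → K}
    (hx : ∀ i ∈ s, x i ∉ w.nonunits) : ∏ i ∈ s, x i ∉ w.nonunits :=
  Finset.prod_induction x (· ∉ w.nonunits) (fun _ _ => mul_notMem_nonunits)
    w.one_notMem_nonunits hx

/-- A valuation ring contains the zeros of `T ^ p - b T - a` for `a`, `b` in the ring. -/
theorem mem_of_pow_eq {w : ValuationSubring K} {p : ℕ} (hp : 2 ≤ p) {a b η : K} (ha : a ∈ w)
    (hb : b ∈ w) (h : η ^ p = b * η + a) : η ∈ w := by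
  by_contra hη
  have hη0 : η ≠ 0 := fun h0 => hη (h0 ▸ w.zero_mem)
  have hinv : η⁻¹ ∈ w.nonunits := w.inv_mem_nonunits_iff.2 (Or.inr hη)
  refine w.one_notMem_nonunits ?_
  obtain ⟨k, rfl⟩ : ∃ k, p = k + 2 := ⟨p - 2, by omega⟩
  have e : (1 : K) = (b * η⁻¹ ^ k + a * η⁻¹ ^ (k + 1)) * η⁻¹ := by
    have : (1 : K) = η ^ (k + 2) * η⁻¹ ^ (k + 2) := by
      rw [← mul_pow, mul_inv_cancel₀ hη0, one_pow]
    rw [this, h]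
    have h1 : η * η⁻¹ = 1 := mul_inv_cancel₀ hη0
    linear_combination b * η⁻¹ ^ (k + 1) * h1
  rw [e]
  have hi := mem_of_mem_nonunits hinv
  exact mul_mem_nonunits_of_mem (w.add_mem _ _ (w.mul_mem _ _ hb (pow_mem hi _))
    (w.mul_mem _ _ ha (pow_mem hi _))) hinv

/-- If `w` is a proper refinement of `u`, both of residue characteristic `p`, then an element that
has positive `w`-value and is a `u`-unit is transcendental over `𝔽_p` in the residue field of `u`:
otherwise its inverse would be integral over `w`. -/
theorem transcendental_residue {w u : ValuationSubring K} (hwu : w ≤ u) {p : ℕ} [Fact p.Prime]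
    [Algebra (ZMod p) (IsLocalRing.ResidueField u)] (t : u) (htw : (t : K) ∈ w.nonunits)
    (htu : (t : K) ∉ u.nonunits) :
    Transcendental (ZMod p) (IsLocalRing.residue u t) := by
  intro halg
  have hint := halg.inv.isIntegral
  obtain ⟨f, hf, hf0⟩ := hint
  have hlift : f ∈ Polynomial.lifts (Int.castRingHom (ZMod p)) :=
    (Polynomial.mem_lifts f).2
      (Polynomial.map_surjective _ (ZMod.ringHom_surjective (Int.castRingHom (ZMod p))) f)
  obtain ⟨g, hg, -, hgm⟩ := Polynomial.lifts_and_natDegree_eq_and_monic hlift hf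
  have ht0 : (t : K) ≠ 0 := fun h => htu (h ▸ u.nonunits.zero_mem)
  let t' : u := ⟨(t : K)⁻¹, inv_mem_of_notMem_nonunits htu⟩
  have htt' : t * t' = 1 := Subtype.ext (mul_inv_cancel₀ ht0)
  have hres : (IsLocalRing.residue u t)⁻¹ = IsLocalRing.residue u t' :=
    inv_eq_of_mul_eq_one_right (by rw [← map_mul, htt', map_one])
  have hzero : IsLocalRing.residue u (g.eval₂ (Int.castRingHom u) t') = 0 := by
    rw [Polynomial.hom_eval₂, ← hres, ← hf0, ← hg, Polynomial.eval₂_map]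
    congr 1
    exact RingHom.ext_int _ _
  have hmem : Polynomial.aeval ((t : K)⁻¹) g ∈ w.nonunits := by
    have h := nonunits_le_nonunits.2 hwu
      (u.coe_mem_nonunits_iff.2 ((IsLocalRing.residue_eq_zero_iff _).1 hzero))
    convert h using 1
    change _ = u.subtype _
    rw [Polynomial.hom_eval₂, Polynomial.aeval_def]
    congr 1
  have hdeg : g.natDegree ≠ 0 := fun h0 => w.one_notMem_nonunits <| by
    simpa [hgm.natDegree_eq_zero.1 h0] using hmem
  have hw : IsIntegral w (Polynomial.aeval ((t : K)⁻¹) (g.map (algebraMap ℤ w))) := by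
    rw [Polynomial.aeval_map_algebraMap]
    exact isIntegral_algebraMap (R := w) (x := ⟨_, mem_of_mem_nonunits hmem⟩)
  have hinv := IsIntegral.of_aeval_monic (hgm.map _) (by rwa [hgm.natDegree_map]) hw
  obtain ⟨x, hx⟩ := IsIntegrallyClosed.isIntegral_iff.1 hinv
  refine w.one_notMem_nonunits ?_
  rw [← inv_mul_cancel₀ ht0, ← hx]
  exact mul_mem_nonunits_of_mem x.2 htw

/-- An equation `z ^ p - c z + p y = α (C / b) ^ p`, with `c = C ^ (p - 1)`, `b` of positive
`w`-value and `C` a `u`-unit, makes `z b / C` a `p`-th root of `α` modulo the maximal ideal of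
`w`. -/
theorem twistedArtinSchreier_ne {v w u : ValuationSubring K} (hvw : v ≤ w) (hwu : w ≤ u) {p : ℕ}
    (hp : p.Prime) (hpu : (p : K) ∈ u.nonunits) {α : K} (hα : α ∈ w)
    (hroot : ∀ η ∈ w, η ^ p - α ∉ w.nonunits) {b C : K} (hb : b ∈ w.nonunits) (hb0 : b ≠ 0)
    (hC : C ∉ u.nonunits) {z y : K} (hy : y ∈ v) :
    z ^ p - C ^ (p - 1) * z + p * y ≠ α * (C / b) ^ p := by
  intro h
  have hC0 : C ≠ 0 := fun h0 => hC (h0 ▸ u.nonunits.zero_mem)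
  have hbw := mem_of_mem_nonunits hb
  set ε : K := y * (b * C⁻¹) ^ p * p with hε
  have hεw : ε ∈ w.nonunits := nonunits_le_nonunits.2 hwu (mul_mem_nonunits_of_mem
    (u.mul_mem _ _ (hwu (hvw hy))
      (pow_mem (u.mul_mem _ _ (hwu hbw) (inv_mem_of_notMem_nonunits hC)) _)) hpu)
  have hp1 : p = (p - 1) + 1 := (Nat.sub_add_cancel hp.one_le).symm
  have key : (z * b / C) ^ p = b ^ (p - 1) * (z * b / C) + (α - ε) := by
    have e1 : z ^ p = C ^ (p - 1) * z - p * y + α * (C / b) ^ p := by rw [← h]; ring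
    have e2 : b ^ p = b ^ (p - 1) * b := by rw [← pow_succ, ← hp1]
    have e3 : C ^ p = C ^ (p - 1) * C := by rw [← pow_succ, ← hp1]
    rw [hε, div_pow, mul_pow, e1, mul_pow, inv_pow, div_pow]
    have : b ^ p ≠ 0 := pow_ne_zero _ hb0
    have : C ^ p ≠ 0 := pow_ne_zero _ hC0
    have : C ^ (p - 1) ≠ 0 := pow_ne_zero _ hC0
    field_simp
    rw [e2, e3]
    ring
  have hη : z * b / C ∈ w :=
    mem_of_pow_eq hp.two_le (sub_mem hα (mem_of_mem_nonunits hεw)) (pow_mem hbw _) key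
  refine hroot _ hη ?_
  have e : (z * b / C) ^ p - α = (z * b / C) * b ^ (p - 1) - ε := by rw [key]; ring
  rw [e]
  exact sub_mem (mul_mem_nonunits_of_mem hη
    (pow_mem_nonunits hb (Nat.sub_ne_zero_of_lt hp.one_lt))) hεw

end ValuationSubring

/-! ### Independence of translates of a twisted Artin–Schreier range -/

theorem Transcendental.linearIndependent_pow {R A : Type*} [CommRing R] [CommRing A] [Algebra R A]
    {x : A} (hx : Transcendental R x) : LinearIndependent R (fun k : ℕ => x ^ k) := by
  have h := (Polynomial.basisMonomials R).linearIndependent.map' (Polynomial.aeval x).toLinearMap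
    (LinearMap.ker_eq_bot.2 (transcendental_iff_injective.1 hx))
  have e : (fun k : ℕ => x ^ k) =
      (Polynomial.aeval x).toLinearMap ∘ Polynomial.basisMonomials R := by
    ext k
    simp
  rw [e]
  exact h

namespace ValuationSubring

variable {K : Type*} [Field K]

/-- **Independence.** Let `v ≤ w < u`, let the residue characteristic of `u` be `p` and let the
residue field of `w` contain an element `α` that is not a `p`-th power. Then the multiplicative
translates by suitable powers of one element `t` of the group `{z ^ p - c z + p y | z, y ∈ v}` are
as independent as possible: every pattern of membership in finitely many of them is realized by a
single element. -/
theorem exists_forall_mul_mem_iff {v w u : ValuationSubring K} (hvw : v ≤ w) (hwu : w < u) {p : ℕ}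
    (hp : p.Prime) (hpu : (p : K) ∈ u.nonunits) {α : K} (hα : α ∈ w)
    (hroot : ∀ η ∈ w, η ^ p - α ∉ w.nonunits) {ι : Type*} [Fintype ι] (e : ι → ℕ)
    (he : Function.Injective e) :
    ∃ (t c : K) (q : ℕ), ∀ J : Set ι, ∃ X : K, ∀ i,
      (∃ z ∈ v, ∃ y ∈ v, t ^ (e i * q) * X = z ^ p - c * z + p * y) ↔ i ∈ J := by
  classical
  have : Fact p.Prime := ⟨hp⟩
  have hvu : v ≤ u := hvw.trans hwu.le
  -- A `u`-unit of positive `w`-value.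
  obtain ⟨t, htw, htu⟩ : ∃ t ∈ w.nonunits, t ∉ u.nonunits := by
    have h := mt nonunits_le_nonunits.1 hwu.not_ge
    exact Set.not_subset.1 h
  have htv : t ∈ v := mem_of_mem_nonunits (nonunits_le_nonunits.2 hvw htw)
  -- The ring `v / p`, which has characteristic `p`, and its map to the residue field of `u`.
  have hpv : (p : v) ∈ IsLocalRing.maximalIdeal v :=
    v.coe_mem_nonunits_iff.1 (by simpa using nonunits_le_nonunits.2 hvu hpu)
  let I : Ideal v := Ideal.span {(p : v)}
  have : CharP (v ⧸ I) p := CharP.quotient v p hpv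
  let mk : v →+* v ⧸ I := Ideal.Quotient.mk I
  have hmk : Function.Surjective mk := Ideal.Quotient.mk_surjective
  have hpres : IsLocalRing.residue u (p : u) = 0 :=
    (IsLocalRing.residue_eq_zero_iff _).2 (u.coe_mem_nonunits_iff.1 (by simpa using hpu))
  have : CharP (IsLocalRing.ResidueField u) p :=
    (CharP.charP_iff_prime_eq_zero hp).2 (by simpa using hpres)
  let _ : Algebra (ZMod p) (IsLocalRing.ResidueField u) := ZMod.algebra _ p
  let res : v →+* IsLocalRing.ResidueField u := (IsLocalRing.residue u).comp (inclusion v u hvu)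
  have hres : ∀ x : v, res x = 0 ↔ (x : K) ∈ u.nonunits := fun x =>
    (IsLocalRing.residue_eq_zero_iff _).trans u.coe_mem_nonunits_iff.symm
  let π : v ⧸ I →+* IsLocalRing.ResidueField u := Ideal.Quotient.lift I res fun x hx => by
    have : I ≤ RingHom.ker res := by
      rw [Ideal.span_le, Set.singleton_subset_iff]
      simp [RingHom.mem_ker]
    exact this hx
  have hπ : ∀ x, π (mk x) = res x := fun x => Ideal.Quotient.lift_mk I _ _
  let θ : ι → v ⧸ I := fun i => mk ⟨t, htv⟩ ^ e i
  have hindep : LinearIndependent (ZMod p) (fun i => π (θ i)) := by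
    have h := (transcendental_residue hwu.le (p := p) ⟨t, hvu htv⟩ htw htu).linearIndependent_pow
    have h' : (fun i => π (θ i)) =
        (fun k : ℕ => IsLocalRing.residue u ⟨t, hvu htv⟩ ^ k) ∘ e := by
      ext i
      simp only [θ, map_pow, hπ, Function.comp_apply]
      rfl
    rw [h']
    exact h.comp e he
  -- For each `i`, an additive polynomial that vanishes at `θⱼ` for `j ≠ i` but not at `θᵢ`.
  let m := Fintype.card ι
  choose a ha hspan using fun i => exists_additivePolynomial (p := p) π θ (Finset.univ.erase i)
    (m + 1) ((Finset.card_le_univ _).trans (Nat.le_succ _))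
  let L : ι → v ⧸ I := fun i => ∑ j ∈ Finset.range (m + 1 + 1), a i j * θ i ^ p ^ j
  have hL : ∀ i, π (L i) ≠ 0 := fun i h0 =>
    hindep.notMem_span_image (s := ((Finset.univ.erase i : Finset ι) : Set ι)) (x := i) (by simp)
      (hspan i (θ i) h0)
  choose l hl using fun i => hmk (L i)
  have hlu : ∀ i, (l i : K) ∉ u.nonunits := fun i h => hL i (by rw [← hl, hπ, (hres _).2 h])
  -- `T` is divisible by every `t * l i`, with a quotient `b i` of positive `w`-value.
  let T : v := ⟨t, htv⟩ ^ 2 * ∏ i, l i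
  let b : ι → K := fun i => t * ∏ j ∈ Finset.univ.erase i, (l j : K)
  have hTb : ∀ i, (T : K) = b i * (t * l i) := by
    intro i
    simp only [T, b, MulMemClass.coe_mul, SubmonoidClass.coe_pow, SubmonoidClass.coe_finsetProd]
    rw [← Finset.mul_prod_erase Finset.univ (fun j => (l j : K)) (Finset.mem_univ i)]
    ring
  have hTu : (T : K) ∉ u.nonunits := by
    simp only [T, MulMemClass.coe_mul, SubmonoidClass.coe_pow, SubmonoidClass.coe_finsetProd]
    exact mul_notMem_nonunits (pow_notMem_nonunits htu 2) (prod_notMem_nonunits fun i _ => hlu i)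
  have hT0 : (T : K) ≠ 0 := fun h => hTu (h ▸ u.nonunits.zero_mem)
  have hb0 : ∀ i, b i ≠ 0 := fun i h => hT0 (by rw [hTb i, h, zero_mul])
  have hbw : ∀ i, b i ∈ w.nonunits := by
    intro i
    rw [show b i = (∏ j ∈ Finset.univ.erase i, (l j : K)) * t from mul_comm _ _]
    exact mul_mem_nonunits_of_mem (prod_mem fun j _ => hvw (l j).2) htw
  have hαt : α * t ^ p ∈ v := mem_of_mem_nonunits (nonunits_le_nonunits.2 hvw
    (mul_mem_nonunits_of_mem hα (pow_mem_nonunits htw hp.ne_zero)))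
  let D : v := T ^ p
  let c : v := D ^ (p ^ (m + 1) - p ^ m)
  let S : ι → v := fun i => ⟨α * t ^ p, hαt⟩ * l i ^ (p - 1)
  let G : AddSubgroup v :=
    (twistedArtinSchreierRange p (mk c)).comap (mk : v →+ v ⧸ I)
  have hG : ∀ x : v, x ∈ G ↔ ∃ z ∈ v, ∃ y ∈ v, (x : K) = z ^ p - c * z + p * y := by
    intro x
    change mk x ∈ twistedArtinSchreierRange p (mk c) ↔ _
    rw [mem_twistedArtinSchreierRange]
    constructor
    · rintro ⟨z, hz⟩
      obtain ⟨z, rfl⟩ := hmk z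
      rw [← map_pow, ← map_mul, ← map_sub, eq_comm, Ideal.Quotient.mk_eq_mk_iff_sub_mem,
        Ideal.mem_span_singleton'] at hz
      obtain ⟨y, hy⟩ := hz
      refine ⟨z, z.2, y, y.2, ?_⟩
      have := congrArg (Subtype.val) hy
      push_cast at this
      linear_combination -this
    · rintro ⟨z, hz, y, hy, h⟩
      refine ⟨mk ⟨z, hz⟩, ?_⟩
      rw [← map_pow, ← map_mul, ← map_sub, eq_comm, Ideal.Quotient.mk_eq_mk_iff_sub_mem,
        Ideal.mem_span_singleton']
      refine ⟨⟨y, hy⟩, Subtype.ext ?_⟩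
      push_cast
      linear_combination -h
  -- The dual system: `Xⱼ` lies in all of the translates except for the `j`-th.
  choose X hX using fun j => hmk (additivePolynomialLift p (m + 1) (a j) (mk (S j)) (mk D))
  have hmem : ∀ i j, (⟨t, htv⟩ ^ (e i * p ^ (m + 1)) * X j : v) ∈ G ↔
      mk D ^ (p ^ (m + 1) - 1) * mk (S j) *
        ∑ k ∈ Finset.range (m + 1 + 1), a j k * θ i ^ p ^ k ∈
        twistedArtinSchreierRange p (mk c) := by
    intro i j
    have h := pow_mul_additivePolynomialLift_sub_mem (p := p) m (a j) (mk (S j)) (mk D) (θ i)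
    have hx : mk (⟨t, htv⟩ ^ (e i * p ^ (m + 1)) * X j) =
        θ i ^ p ^ (m + 1) * additivePolynomialLift p (m + 1) (a j) (mk (S j)) (mk D) := by
      rw [map_mul, hX, map_pow, pow_mul]
    rw [← map_pow mk D, ← hx] at h
    change mk _ ∈ twistedArtinSchreierRange p (mk c) ↔ _
    constructor
    · intro h'
      have := AddSubgroup.sub_mem _ h' h
      rwa [sub_sub_cancel] at this
    · intro h'
      have := AddSubgroup.add_mem _ h h'
      rwa [sub_add_cancel] at this
  have hne : ∀ i j, i ≠ j → (⟨t, htv⟩ ^ (e i * p ^ (m + 1)) * X j : v) ∈ G := by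
    intro i j hij
    rw [hmem, ha j i (by simp [hij]), mul_zero]
    exact AddSubgroup.zero_mem _
  have hself : ∀ i, (⟨t, htv⟩ ^ (e i * p ^ (m + 1)) * X i : v) ∉ G := by
    intro i h
    rw [hmem] at h
    have h' : (D ^ (p ^ (m + 1) - 1) * S i * l i : v) ∈ G := by
      change mk _ ∈ twistedArtinSchreierRange p (mk c)
      rw [map_mul, map_mul, map_pow, hl]
      exact h
    obtain ⟨z, -, y, hy, hz⟩ := (hG _).1 h'
    -- With `C = D ^ p ^ m`, the parameter `c` is `C ^ (p - 1)`.
    refine twistedArtinSchreier_ne hvw hwu.le hp hpu hα hroot (hbw i) (hb0 i)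
      (C := (T : K) ^ p ^ (m + 1)) (pow_notMem_nonunits hTu _) (z := z) hy ?_
    have hc : (c : K) = ((T : K) ^ p ^ (m + 1)) ^ (p - 1) := by
      simp only [c, D, SubmonoidClass.coe_pow]
      rw [← pow_mul, ← pow_mul]
      congr 1
      rw [Nat.mul_sub, Nat.mul_sub, mul_one, pow_succ, mul_comm p (p ^ m)]
      congr 1
      ring
    rw [← hc, ← hz]
    have hp1 : p - 1 + 1 = p := Nat.sub_add_cancel hp.one_le
    have hD : (T : K) ^ (p ^ (m + 1) * p) = (T : K) ^ (p * (p ^ (m + 1) - 1)) * (T : K) ^ p := by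
      rw [← pow_add]
      congr 1
      have : 1 ≤ p ^ (m + 1) := Nat.one_le_pow _ _ hp.pos
      rw [← Nat.mul_succ, Nat.succ_eq_add_one, Nat.sub_add_cancel this, mul_comm]
    have hTp : (T : K) ^ p = b i ^ p * (t ^ p * ((l i : K) ^ (p - 1) * l i)) := by
      rw [hTb i, ← pow_succ, hp1, ← mul_pow, ← mul_pow]
    have hbp : b i ^ p ≠ 0 := pow_ne_zero _ (hb0 i)
    simp only [S, D, MulMemClass.coe_mul, SubmonoidClass.coe_pow]
    rw [div_pow, ← pow_mul, ← pow_mul, hD, hTp]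
    generalize b i ^ p = B at hbp
    field_simp
  refine ⟨t, c, p ^ (m + 1), fun J => ⟨(∑ j with j ∉ J, X j : v), fun i => ?_⟩⟩
  have h := hG (⟨t, htv⟩ ^ (e i * p ^ (m + 1)) * ∑ j with j ∉ J, X j)
  push_cast at h
  push_cast
  rw [← h, Finset.mul_sum]
  by_cases hi : i ∈ J
  · refine iff_of_true (sum_mem fun j hj => hne i j ?_) hi
    rintro rfl
    exact (Finset.mem_filter.1 hj).2 hi
  · refine iff_of_false (fun hs => hself i ?_) hi
    rw [← Finset.add_sum_erase _ _ (Finset.mem_filter.2 ⟨Finset.mem_univ i, hi⟩)] at hs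
    exact (add_mem_cancel_right (sum_mem fun j hj => hne i j (Finset.ne_of_mem_erase hj).symm)).1 hs

end ValuationSubring

/-! ### Coarsenings with imperfect residue field -/

namespace ValuationSubring

variable {K : Type*} [Field K]

theorem natCast_mem_nonunits_iff {u : ValuationSubring K} {p : ℕ} :
    (p : K) ∈ u.nonunits ↔ (p : IsLocalRing.ResidueField u) = 0 := by
  rw [← map_natCast (IsLocalRing.residue u), IsLocalRing.residue_eq_zero_iff,
    ← u.coe_mem_nonunits_iff]
  simp

/-- If the residue field of a coarsening `w` of `v` is imperfect, then `v` and `w` have the same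
positive residue characteristic. -/
theorem charP_of_not_perfectField {v w : ValuationSubring K} (hvw : v ≤ w) {p : ℕ}
    [CharP (IsLocalRing.ResidueField v) p] (hw : ¬ PerfectField (IsLocalRing.ResidueField w)) :
    p.Prime ∧ CharP (IsLocalRing.ResidueField w) p := by
  obtain ⟨q, hq⟩ := CharP.exists (IsLocalRing.ResidueField w)
  rcases CharP.char_is_prime_or_zero (IsLocalRing.ResidueField w) q with hqp | rfl
  · have h : (q : K) ∈ v.nonunits :=
      nonunits_le_nonunits.2 hvw (natCast_mem_nonunits_iff.2 (CharP.cast_eq_zero _ q))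
    have hdvd := (CharP.cast_eq_zero_iff _ p q).1 (natCast_mem_nonunits_iff.1 h)
    obtain rfl := ((Nat.dvd_prime hqp).1 hdvd).resolve_left
      (CharP.char_ne_one (IsLocalRing.ResidueField v) p)
    exact ⟨hqp, hq⟩
  · have := CharP.charP_to_charZero (IsLocalRing.ResidueField w)
    exact absurd (inferInstance : PerfectField (IsLocalRing.ResidueField w)) hw

/-- An imperfect residue field of characteristic `p` has an element without `p`-th root; `α` is a
lift of it to the valuation ring. -/
theorem exists_pow_sub_notMem_nonunits {w : ValuationSubring K} {p : ℕ} (hp : p.Prime)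
    [CharP (IsLocalRing.ResidueField w) p] (hw : ¬ PerfectField (IsLocalRing.ResidueField w)) :
    ∃ α ∈ w, ∀ η ∈ w, η ^ p - α ∉ w.nonunits := by
  have : Fact p.Prime := ⟨hp⟩
  by_contra! h
  refine hw ?_
  have : PerfectRing (IsLocalRing.ResidueField w) p := by
    refine PerfectRing.ofSurjective _ p fun x => ?_
    obtain ⟨α, rfl⟩ := IsLocalRing.residue_surjective x
    obtain ⟨η, hη, hmem⟩ := h α α.2
    refine ⟨IsLocalRing.residue w ⟨η, hη⟩, ?_⟩
    rw [frobenius_def, ← map_pow, ← sub_eq_zero, ← map_sub, IsLocalRing.residue_eq_zero_iff,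
      ← w.coe_mem_nonunits_iff]
    exact hmem
  exact PerfectRing.toPerfectField _ p

/-- In an `NIPₙ` valued field, a coarsening with imperfect residue field has no proper coarsening
of the same positive residue characteristic. -/
theorem not_isNIP_of_lt {v w u : ValuationSubring K} (hvw : v ≤ w) (hwu : w < u) {p : ℕ}
    (hp : p.Prime) [CharP (IsLocalRing.ResidueField w) p] [CharP (IsLocalRing.ResidueField u) p]
    (hw : ¬ PerfectField (IsLocalRing.ResidueField w)) (n : ℕ) :
    ¬ IsNIP (valuedFieldTheory v) n := by
  obtain ⟨α, hα, hroot⟩ := exists_pow_sub_notMem_nonunits hp hw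
  have hpu : (p : K) ∈ u.nonunits := natCast_mem_nonunits_iff.2 (CharP.cast_eq_zero _ p)
  intro hNIP
  refine hNIP 2 (fun _ => 1) (twistedArtinSchreierFormula p n) ?_
  let _ := valuedFieldStructure v
  refine hasIndependenceProperty_of_boxes K _ fun N => ?_
  -- Expansion in base `N` numbers the points of the box, and makes the powers of `t` products.
  obtain ⟨t, c, q, h⟩ := exists_forall_mul_mem_iff hvw hwu hp hpu hα hroot
    (fun I : Fin n → Fin N => (finFunctionFinEquiv I : ℕ))
    (Fin.val_injective.comp finFunctionFinEquiv.injective)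
  choose X hX using h
  refine ⟨fun k m _ => t ^ (m * N ^ (k : ℕ) * q),
    fun J => ![X {I | (fun k => (I k : ℕ)) ∈ J}, c], fun J i hi => ?_⟩
  rw [realize_twistedArtinSchreierFormula]
  have h := hX {I | (fun k => (I k : ℕ)) ∈ J} (fun k => ⟨i k, hi k⟩)
  rw [finFunctionFinEquiv_apply, Finset.sum_mul, ← Finset.prod_pow_eq_pow_sum] at h
  exact h

end ValuationSubring

theorem mainTheorem10 {K : Type*} [Field K] (v : ValuationSubring K) (p : ℕ)
    (hp : CharP (IsLocalRing.ResidueField v) p)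
    (n : ℕ) (hn : 1 ≤ n) (hNIP : IsNIP (valuedFieldTheory v) n)
    (hv : 0 < p → IsPHenselian p v) :
    (∀ w₁ w₂ : ValuationSubring K, v ≤ w₁ → v ≤ w₂ →
      ¬ PerfectField (IsLocalRing.ResidueField w₁) →
      ¬ PerfectField (IsLocalRing.ResidueField w₂) → w₁ = w₂) ∧
    (∀ w : ValuationSubring K, v ≤ w → ¬ PerfectField (IsLocalRing.ResidueField w) →
      0 < p ∧
      IsGreatest {u : ValuationSubring K | v ≤ u ∧ CharP (IsLocalRing.ResidueField u) p} w) := by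
  have key : ∀ w : ValuationSubring K, v ≤ w → ¬ PerfectField (IsLocalRing.ResidueField w) →
      0 < p ∧
      IsGreatest {u : ValuationSubring K | v ≤ u ∧ CharP (IsLocalRing.ResidueField u) p} w := by
    intro w hvw hw
    obtain ⟨hprime, hchar⟩ := ValuationSubring.charP_of_not_perfectField (p := p) hvw hw
    refine ⟨hprime.pos, ⟨hvw, hchar⟩, ?_⟩
    rintro u ⟨hvu, hu⟩
    -- The coarsenings of `v` are linearly ordered.
    by_contra hle
    have hwu : w < u :=
      lt_of_le_not_ge ((le_total (⟨u, hvu⟩ : {S // v ≤ S}) ⟨w, hvw⟩).resolve_left hle) hle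
    exact ValuationSubring.not_isNIP_of_lt hvw hwu hprime hw n hNIP
  exact ⟨fun w₁ w₂ h₁ h₂ hw₁ hw₂ => (key w₁ h₁ hw₁).2.unique (key w₂ h₂ hw₂).2, key⟩
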